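/- Let $G$ be a finite simple connected graph of order $n \ge 2$ with maximum degree at most $\Delta$, where $\Delta \ge 2$ is an integer, and suppose that $n^{\Delta} \ge 7$ (that is, $(n,\Delta) \ne (2,2)$). Let $\boxtimes G^{\Delta}$ be the $\Delta$-th strong power of $G$: its vertices are the $\Delta$-tuples of vertices of $G$, and two distinct tuples $x, y$ are adjacent if and only if for every $i$ either $x_i = y_i$ or $x_i y_i \in E(G)$. Then $D'(\boxtimes G^{\Delta}) = 2$, where the distinguishing index $D'(H)$ of a graph $H$ is the least integer $d$ such that $H$ has a (not necessarily proper) labeling of its edges with $d$ labels that is preserved by no automorphism of $H$ other than the identity. -/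

import Mathlib

namespace SimpleGraph

/-- The strong product of a family of graphs: two distinct tuples are adjacent when in every
coordinate their entries are equal or adjacent. -/
def strongProduct {ι : Type*} {V : ι → Type*} (G : ∀ i, SimpleGraph (V i)) :
    SimpleGraph (∀ i, V i) where
  Adj x y := x ≠ y ∧ ∀ i, x i = y i ∨ (G i).Adj (x i) (y i)
  symm := ⟨fun _ _ h => ⟨h.1.symm, fun i => (h.2 i).imp Eq.symm (fun h' => h'.symm)⟩⟩
  loopless := ⟨fun _ h => h.1 rfl⟩

/-- The `k`-th strong power of `G`, the strong product of `k` copies of `G`. -/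
def strongPower {V : Type*} (G : SimpleGraph V) (k : ℕ) : SimpleGraph (Fin k → V) :=
  strongProduct fun _ : Fin k => G

/-- An edge labeling is distinguishing if the identity is the only automorphism of the graph
that preserves the labels of all edges. The labeling need not be proper. -/
def IsDistinguishingEdgeLabeling {V K : Type*} (G : SimpleGraph V) (c : G.edgeSet → K) : Prop :=
  ∀ σ : G ≃g G, (∀ e : G.edgeSet, c (σ.mapEdgeSet e) = c e) → ∀ v, σ v = v

/-- The distinguishing index of `G`: the least number `d` such that `G` has a distinguishing edge
labeling with `d` labels. It is `⊤` if no such `d` exists. -/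
noncomputable def distinguishingIndex {V : Type*} (G : SimpleGraph V) : ℕ∞ :=
  ⨅ (d : ℕ) (_ : ∃ c : G.edgeSet → Fin d, G.IsDistinguishingEdgeLabeling c), (d : ℕ∞)

end SimpleGraph

/-!
A rigid spanning subgraph `H` of a graph `X` gives a distinguishing labeling with two labels:
label the edges of `H` by one label and the other edges by the second one. One label does not
suffice for a strong power with at least two factors, since interchanging two coordinates is a
nontrivial automorphism. It remains to find rigid spanning subgraphs of strong powers.

Let `G` have at least three vertices, choose a vertex `r` of largest degree and a breadth-first
spanning tree with root `r`. In the strong square, the Cartesian square of this tree is made rigid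
by adding a few diagonal edges: `(r, r)` is joined to all pairs of neighbours of `r`, which makes
it the only vertex of largest degree; its neighbours are told apart by their common neighbours
with it; and every vertex further away is determined by two vertices closer to `(r, r)`.

A higher power is the strong product of `G` with a power that already has a connected rigid
spanning subgraph `K`. Copies of `K`, one for each vertex of the tree, are joined by one edge for
each edge of the tree. Such an edge cuts off a union of whole copies of `K`, whereas a cut by an
edge inside one copy has a side whose size is not divisible by the order of `K`. So automorphisms
permute the copies, and by rigidity of `K` they act as the identity inside them. Joining distinct
tree vertices to their parents at distinct vertices of `K` then makes every automorphism fix every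
tree edge, hence the tree.

If `G` has two vertices, then its strong powers are complete graphs, and a complete graph with at
least six vertices contains a rigid fan.
-/

open Finset SimpleGraph

section Rigid

variable {V W : Type*} {H : SimpleGraph V}

/-- A graph is *rigid* if the identity is its only automorphism. -/
def IsRigid (H : SimpleGraph V) : Prop :=
  ∀ (σ : H ≃g H) (v : V), σ v = v

theorem IsRigid.of_iso {K : SimpleGraph W} (hH : IsRigid H) (e : H ≃g K) : IsRigid K :=
  fun σ w => by simpa using congrArg e (hH ((e.trans σ).trans e.symm) (e.symm w))

/-- The graph `X` has a connected rigid spanning subgraph. -/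
def HasRigidSpanningSubgraph (X : SimpleGraph V) : Prop :=
  ∃ H ≤ X, H.Connected ∧ IsRigid H

theorem HasRigidSpanningSubgraph.of_iso {X : SimpleGraph V} {Y : SimpleGraph W}
    (hX : HasRigidSpanningSubgraph X) (e : X ≃g Y) : HasRigidSpanningSubgraph Y := by
  obtain ⟨H, hle, hconn, hrigid⟩ := hX
  let eH : H.comap e.symm ≃g H := Iso.comap e.symm.toEquiv H
  exact ⟨H.comap e.symm, fun a b hab => e.symm.map_adj_iff.1 (hle hab),
    eH.connected_iff.2 hconn, hrigid.of_iso eH.symm⟩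

theorem distinguishingIndex_le_two_of_isRigid {X : SimpleGraph V} (hle : H ≤ X)
    (hH : IsRigid H) : X.distinguishingIndex ≤ 2 := by
  classical
  let c : X.edgeSet → Fin 2 := fun e => if (e : Sym2 V) ∈ H.edgeSet then 1 else 0
  have hc : X.IsDistinguishingEdgeLabeling c := fun σ hσ v => by
    refine hH ⟨σ.toEquiv, fun {a b} => ?_⟩ v
    by_cases hab : X.Adj a b
    · have hlabel : (if H.Adj (σ a) (σ b) then (1 : Fin 2) else 0) = if H.Adj a b then 1 else 0 :=
        hσ ⟨s(a, b), hab⟩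
      have hmem : H.Adj (σ a) (σ b) ↔ H.Adj a b := by split_ifs at hlabel <;> simp_all
      exact hmem
    · exact iff_of_false (fun h => hab (σ.map_adj_iff.1 (hle h))) (fun h => hab (hle h))
  exact iInf₂_le_of_le 2 ⟨c, hc⟩ le_rfl

theorem two_le_distinguishingIndex {X : SimpleGraph V} (σ : X ≃g X) {v : V} (hv : σ v ≠ v) :
    2 ≤ X.distinguishingIndex := by
  refine le_iInf₂ fun d ⟨c, hc⟩ => ?_
  suffices 2 ≤ d by exact_mod_cast this
  by_contra! hd
  have : Subsingleton (Fin d) := Fin.subsingleton_iff_le_one.2 (by lia)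
  exact hv (hc σ (fun _ => Subsingleton.elim _ _) v)

end Rigid

section StrongPower

variable {V : Type*} (G : SimpleGraph V)

/-- The automorphism of a strong power given by a permutation of the coordinates. -/
def strongPowerPermIso {k : ℕ} (π : Equiv.Perm (Fin k)) : G.strongPower k ≃g G.strongPower k where
  toEquiv := π.arrowCongr (Equiv.refl V)
  map_rel_iff' := and_congr (not_congr (Equiv.injective _).eq_iff)
    (π.symm.surjective.forall (p := fun _ => _ = _ ∨ G.Adj _ _)).symm

theorem two_le_distinguishingIndex_strongPower [Nontrivial V] {k : ℕ} (hk : 2 ≤ k) :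
    2 ≤ (G.strongPower k).distinguishingIndex := by
  obtain ⟨a, b, hab⟩ := exists_pair_ne V
  let i : Fin k := ⟨0, by lia⟩
  let j : Fin k := ⟨1, by lia⟩
  have hij : i ≠ j := by simp [i, j]
  let x : Fin k → V := Function.update (fun _ => b) i a
  refine two_le_distinguishingIndex (strongPowerPermIso G (Equiv.swap i j)) (v := x) fun h => ?_
  have hx : x (Equiv.swap i j i) = x i := congrFun h i
  rw [Equiv.swap_apply_left] at hx
  exact hab (by simpa [x, hij.symm] using hx.symm)

theorem strongPower_top (k : ℕ) : (⊤ : SimpleGraph V).strongPower k = ⊤ := by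
  ext x y
  simp [strongPower, strongProduct, em]

/-- The strong product of two graphs, on pairs of vertices. -/
def strongProd {Y : Type*} (K : SimpleGraph Y) : SimpleGraph (V × Y) where
  Adj a b := a ≠ b ∧ (a.1 = b.1 ∨ G.Adj a.1 b.1) ∧ (a.2 = b.2 ∨ K.Adj a.2 b.2)
  symm := ⟨fun _ _ h => ⟨h.1.symm, h.2.1.imp Eq.symm Adj.symm, h.2.2.imp Eq.symm Adj.symm⟩⟩
  loopless := ⟨fun _ h => h.1 rfl⟩

/-- The strong square as a strong product of two factors. -/
def strongPowerTwoIso : strongProd G G ≃g G.strongPower 2 where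
  toEquiv := (finTwoArrowEquiv V).symm
  map_rel_iff' := and_congr (not_congr (Equiv.injective _).eq_iff) Fin.forall_fin_two

/-- A strong power with its first factor split off. -/
def strongPowerSuccIso (k : ℕ) : strongProd G (G.strongPower k) ≃g G.strongPower (k + 1) where
  toEquiv := Fin.consEquiv fun _ => V
  map_rel_iff' {a b} := by
    refine and_congr (not_congr (Equiv.injective _).eq_iff) (Fin.forall_fin_succ.trans ?_)
    refine and_congr_right fun _ => ⟨fun h => ?_, fun h => ?_⟩
    · exact or_iff_not_imp_left.2 fun hne => ⟨hne, h⟩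
    · exact h.elim (fun heq i => Or.inl (congrFun heq i)) fun hadj => hadj.2

end StrongPower

section Fixing

variable {V : Type*} {H : SimpleGraph V} (σ : H ≃g H)

theorem apply_mem_commonNeighbors {a b v : V} (ha : σ a = a) (hb : σ b = b)
    (hv : v ∈ H.commonNeighbors a b) : σ v ∈ H.commonNeighbors a b := by
  have hσv : σ v ∈ H.commonNeighbors (σ a) (σ b) :=
    ⟨σ.map_adj_iff.2 hv.1, σ.map_adj_iff.2 hv.2⟩
  rwa [ha, hb] at hσv

theorem apply_eq_of_mem_commonNeighbors {a b v : V} (ha : σ a = a) (hb : σ b = b)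
    (hv : v ∈ H.commonNeighbors a b) (huniq : ∀ w ∈ H.commonNeighbors a b, w = v ∨ σ w = w) :
    σ v = v :=
  (huniq _ (apply_mem_commonNeighbors σ ha hb hv)).elim id fun h => σ.injective h

/-- `v` is the only common neighbour of `a` and `b` that does not have smaller rank, and `a` and `b`
have smaller rank as well. Hence `v` is fixed as soon as all vertices of smaller rank are. -/
structure IsAnchorPair (H : SimpleGraph V) (rank : V → ℕ) (v a b : V) : Prop where
  rank_left : rank a < rank v
  rank_right : rank b < rank v
  mem : v ∈ H.commonNeighbors a b
  eq_or_rank_lt : ∀ w ∈ H.commonNeighbors a b, w = v ∨ rank w < rank v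

theorem apply_eq_of_isAnchorPair (rank : V → ℕ) (S : Set V) (hS : ∀ v ∈ S, σ v = v)
    (hanchor : ∀ v ∉ S, ∃ a b, IsAnchorPair H rank v a b) (v : V) : σ v = v := by
  induction hn : rank v using Nat.strong_induction_on generalizing v with
  | _ n ih =>
    subst hn
    by_cases hv : v ∈ S
    · exact hS v hv
    obtain ⟨a, b, ha, hb, hab, huniq⟩ := hanchor v hv
    exact apply_eq_of_mem_commonNeighbors σ (ih _ ha a rfl) (ih _ hb b rfl) hab fun w hw =>
      (huniq w hw).imp_right fun hlt => ih _ hlt w rfl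

theorem ncard_neighborSet_apply (v : V) :
    (H.neighborSet (σ v)).ncard = (H.neighborSet v).ncard :=
  (Nat.card_congr (σ.mapNeighborSet v)).symm

theorem apply_eq_of_ncard_neighborSet_lt {c : V}
    (hc : ∀ v ≠ c, (H.neighborSet v).ncard < (H.neighborSet c).ncard) : σ c = c := by
  by_contra hne
  exact (hc _ hne).ne (ncard_neighborSet_apply σ c)

theorem ncard_commonNeighbors_apply {c : V} (hc : σ c = c) (v : V) :
    (H.commonNeighbors c (σ v)).ncard = (H.commonNeighbors c v).ncard := by
  have himage : H.commonNeighbors c (σ v) = σ '' H.commonNeighbors c v := by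
    ext w
    obtain ⟨w, rfl⟩ := σ.surjective w
    rw [σ.injective.mem_set_image, mem_commonNeighbors, mem_commonNeighbors]
    exact and_congr (by simpa only [hc] using σ.map_adj_iff (v := c) (w := w)) σ.map_adj_iff
  rw [himage, Set.ncard_image_of_injective _ σ.injective]

end Fixing

theorem ncard_insert_insert_singleton_le {α : Type*} (a b c : α) :
    ({a, b, c} : Set α).ncard ≤ 3 := by
  refine (Set.ncard_insert_le a _).trans (Nat.succ_le_succ ?_)
  exact (Set.ncard_insert_le b _).trans_eq (by rw [Set.ncard_singleton])

section Fan

/-- The path on `0, …, n - 2` together with a hub `n - 1` joined to all of it except `0`. -/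
def fanGraph (n : ℕ) : SimpleGraph (Fin n) :=
  fromRel fun i j => (i : ℕ) + 1 = j ∨ (i : ℕ) ≠ 0 ∧ (j : ℕ) + 1 = n

variable {n : ℕ}

theorem fanGraph_adj {i j : Fin n} : (fanGraph n).Adj i j ↔ (i : ℕ) ≠ j ∧
    ((i : ℕ) + 1 = j ∨ (j : ℕ) + 1 = i ∨ (i : ℕ) ≠ 0 ∧ (j : ℕ) + 1 = n ∨
      (j : ℕ) ≠ 0 ∧ (i : ℕ) + 1 = n) := by
  simp only [fanGraph, fromRel_adj, ne_eq, Fin.ext_iff]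
  tauto

theorem ncard_neighborSet_fanGraph_le {i : Fin n} (hi : (i : ℕ) + 1 ≠ n) :
    ((fanGraph n).neighborSet i).ncard ≤ 3 := by
  have hsub : Fin.val '' (fanGraph n).neighborSet i ⊆ {(i : ℕ) - 1, (i : ℕ) + 1, n - 1} := by
    rintro _ ⟨j, hj, rfl⟩
    rw [mem_neighborSet, fanGraph_adj] at hj
    simp only [Set.mem_insert_iff, Set.mem_singleton_iff]
    lia
  rw [← Set.ncard_image_of_injective _ Fin.val_injective]
  exact (Set.ncard_le_ncard hsub).trans (ncard_insert_insert_singleton_le _ _ _)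

theorem le_ncard_neighborSet_fanGraph {i : Fin n} (hi : (i : ℕ) + 1 = n) :
    n - 2 ≤ ((fanGraph n).neighborSet i).ncard := by
  have hsub : (Finset.Ico 1 (n - 1) : Set ℕ) ⊆ Fin.val '' (fanGraph n).neighborSet i := by
    intro j hj
    simp only [Finset.coe_Ico, Set.mem_Ico] at hj
    exact ⟨⟨j, by lia⟩, fanGraph_adj.2 (by simp only; lia), rfl⟩
  have := Set.ncard_le_ncard hsub (Set.toFinite _)
  rw [Set.ncard_image_of_injective _ Fin.val_injective, Set.ncard_coe_finset, Nat.card_Ico] at this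
  lia

theorem fanGraph_isRigid (hn : 6 ≤ n) : IsRigid (fanGraph n) := by
  intro σ
  let zero : Fin n := ⟨0, by lia⟩
  let hub : Fin n := ⟨n - 1, by lia⟩
  have hhub : σ hub = hub := by
    refine apply_eq_of_ncard_neighborSet_lt σ fun i hi => ?_
    have hi' : (i : ℕ) + 1 ≠ n := fun h => hi (Fin.ext (by simp only [hub]; lia))
    have hlow := ncard_neighborSet_fanGraph_le hi'
    have hhigh := le_ncard_neighborSet_fanGraph (i := hub) (by simp only [hub]; lia)
    lia
  have hnonadj (i : Fin n) : i ≠ hub ∧ ¬(fanGraph n).Adj hub i ↔ i = zero := by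
    simp only [fanGraph_adj, Fin.ext_iff, zero, hub, ne_eq]
    lia
  have hzero : σ zero = zero := by
    rw [← hnonadj]
    have := (hnonadj zero).2 rfl
    rw [← hhub, σ.map_adj_iff, σ.injective.ne_iff]
    exact this
  let rank : Fin n → ℕ := fun i => if (i : ℕ) + 1 = n then 0 else i
  refine apply_eq_of_isAnchorPair σ rank {zero, hub} (by simp [hhub, hzero]) fun i hi => ?_
  simp only [Set.mem_insert_iff, Set.mem_singleton_iff, Fin.ext_iff, zero, hub] at hi
  refine ⟨⟨i - 1, by lia⟩, hub, ?_, ?_, ?_, ?_⟩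
  all_goals
    simp only [mem_commonNeighbors, fanGraph_adj, Fin.ext_iff, hub, rank]
    grind

theorem exists_isRigid {V : Type*} [Fintype V] (hV : 6 ≤ Fintype.card V) :
    ∃ H : SimpleGraph V, IsRigid H :=
  ⟨_, (fanGraph_isRigid hV).of_iso (Iso.map (Fintype.equivFin V).symm _)⟩

end Fan

section Tree

variable {V : Type*} {G : SimpleGraph V} {r : V}

/-- A breadth-first spanning tree of `G` with root `r`, given by its parent map. The root is its own
parent. -/
structure ParentMap (G : SimpleGraph V) (r : V) where
  parent : V → V
  parent_root : parent r = r
  adj_parent : ∀ x ≠ r, G.Adj x (parent x)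
  dist_parent : ∀ x ≠ r, G.dist r (parent x) + 1 = G.dist r x

theorem exists_adj_dist_add_one_eq (hG : G.Connected) {x : V} (hx : x ≠ r) :
    ∃ y, G.Adj x y ∧ G.dist r y + 1 = G.dist r x := by
  obtain ⟨w, hw⟩ := hG.exists_walk_length_eq_dist x r
  cases w with
  | nil => exact absurd rfl hx
  | @cons _ y _ hxy w =>
    refine ⟨y, hxy, ?_⟩
    have hle : G.dist y r ≤ w.length := dist_le w
    have htri := hG.dist_triangle (u := x) (v := y) (w := r)
    rw [dist_eq_one_iff_adj.2 hxy] at htri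
    rw [Walk.length_cons] at hw
    rw [dist_comm (u := r), dist_comm (u := r)]
    lia

theorem nonempty_parentMap (hG : G.Connected) (r : V) : Nonempty (ParentMap G r) := by
  classical
  choose! p hadj hdist using fun (x : V) (hx : x ≠ r) => exists_adj_dist_add_one_eq hG hx
  refine ⟨⟨fun x => if x = r then r else p x, if_pos rfl, fun x hx => ?_, fun x hx => ?_⟩⟩
  · simpa only [if_neg hx] using hadj x hx
  · simpa only [if_neg hx] using hdist x hx

namespace ParentMap

variable (P : ParentMap G r)

theorem parent_ne {x : V} (hx : x ≠ r) : P.parent x ≠ x :=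
  (P.adj_parent x hx).ne'

theorem parent_eq_root_iff {x : V} (hx : x ≠ r) : P.parent x = r ↔ G.Adj r x := by
  have hdist := P.dist_parent x hx
  refine ⟨fun h => h ▸ (P.adj_parent x hx).symm, fun h => ?_⟩
  rw [dist_eq_one_iff_adj.2 h, Nat.add_eq_right] at hdist
  have hreach : G.Reachable r (P.parent x) := h.reachable.trans (P.adj_parent x hx).reachable
  exact (hreach.dist_eq_zero_iff.1 hdist).symm

@[elab_as_elim]
theorem induction {Q : V → Prop} (root : Q r)
    (step : ∀ x ≠ r, Q (P.parent x) → Q x) (x : V) : Q x := by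
  induction h : G.dist r x using Nat.strong_induction_on generalizing x with
  | _ n ih =>
    by_cases hx : x = r
    · exact hx ▸ root
    · have := P.dist_parent x hx
      exact step x hx (ih _ (by lia) _ rfl)

/-- If `τ` does not fix everything, then it fixes nothing, hence swaps the ends of all tree edges,
which forces the tree to be a single edge. -/
theorem apply_eq_of_sym2_eq [Finite V] (hV : 3 ≤ Nat.card V) {τ : V → V}
    (hτ : ∀ x ≠ r, s(τ x, τ (P.parent x)) = s(x, P.parent x)) (x : V) : τ x = x := by
  classical
  have hconst (x : V) : τ x = x ↔ τ r = r := by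
    induction x using P.induction with
    | root => rfl
    | step x hx ih => grind [hτ x hx]
  rw [hconst]
  by_contra hr
  have hswap {x : V} (hx : x ≠ r) : τ x = P.parent x ∧ τ (P.parent x) = x := by
    grind [hτ x hx, hconst x]
  have hparent {x : V} (hx : x ≠ r) : P.parent x = r := by
    by_contra hpx
    have hx' : P.parent (P.parent x) = x := (hswap hpx).1.symm.trans (hswap hx).2
    have hdist := P.dist_parent x hx
    have hdist' := P.dist_parent _ hpx
    rw [hx'] at hdist'
    lia
  have hsub : Set.univ ⊆ {r, τ r} := fun x _ => by
    by_cases hx : x = r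
    · exact Or.inl hx
    · exact Or.inr ((hparent hx ▸ (hswap hx).2).symm)
  have hcard := (Set.ncard_le_ncard hsub).trans (Set.ncard_insert_le _ _)
  rw [Set.ncard_univ, Set.ncard_singleton] at hcard
  lia

end ParentMap

end Tree

section Cut

variable {V W : Type*} {H : SimpleGraph V} {K : SimpleGraph W}

/-- The edge from `a` to `b` is the only edge leaving some set whose size is a multiple of `m`. -/
def IsCut (H : SimpleGraph V) (m : ℕ) (a b : V) : Prop :=
  ∃ S : Finset V, a ∈ S ∧ b ∉ S ∧ m ∣ S.card ∧ ∀ v ∈ S, ∀ w ∉ S, H.Adj v w → v = a ∧ w = b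

theorem IsCut.map {m : ℕ} {a b : V} (h : IsCut H m a b) (e : H ≃g K) : IsCut K m (e a) (e b) := by
  obtain ⟨S, ha, hb, hm, hS⟩ := h
  let T : Finset W := S.map e.toEquiv.toEmbedding
  have hT (v : V) : e v ∈ T ↔ v ∈ S := Finset.mem_map' _
  refine ⟨T, (hT a).2 ha, (hT b).not.2 hb, by rwa [Finset.card_map], fun v hv w hw hvw => ?_⟩
  obtain ⟨v, rfl⟩ := e.surjective v
  obtain ⟨w, rfl⟩ := e.surjective w
  obtain ⟨rfl, rfl⟩ := hS v ((hT v).1 hv) w ((hT w).not.1 hw) (e.map_adj_iff.1 hvw)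
  exact ⟨rfl, rfl⟩

end Cut

section JoinCopies

theorem eq_of_forall_adj_eq {V α : Type*} {G : SimpleGraph V} (hG : G.Connected) {f : V → α}
    (hf : ∀ a b, G.Adj a b → f a = f b) (a b : V) : f a = f b := by
  obtain ⟨w⟩ := hG.preconnected a b
  induction w with
  | nil => rfl
  | cons h _ ih => exact (hf _ _ h).trans ih

theorem card_eq_sum_card_fibre {V Y : Type*} [Fintype V] [Fintype Y] [DecidableEq V]
    [DecidableEq Y] (S : Finset (V × Y)) : S.card = ∑ x, #{y | (x, y) ∈ S} :=
  calc S.card = ∑ a, if a ∈ S then 1 else 0 := by simp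
    _ = ∑ x, ∑ y, if (x, y) ∈ S then 1 else 0 := Fintype.sum_prod_type _
    _ = ∑ x, #{y | (x, y) ∈ S} := by simp only [Finset.card_filter]

namespace ParentMap

variable {V Y : Type*} {G : SimpleGraph V} {r : V} (P : ParentMap G r) {K : SimpleGraph Y}
  {f : V → Y}

/-- Copies of `K` indexed by the vertices `x` of a rooted tree; the copy at `x` is joined to the
copy at the parent of `x` by a single edge, which joins the two copies of `f x`. -/
def joinCopies (K : SimpleGraph Y) (f : V → Y) : SimpleGraph (V × Y) where
  Adj a b := (a.1 = b.1 ∧ K.Adj a.2 b.2) ∨ ∃ x ≠ r, s(a, b) = s((x, f x), (P.parent x, f x))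
  symm := ⟨fun a b h => h.imp (fun h => ⟨h.1.symm, h.2.symm⟩)
    fun ⟨x, hx, h⟩ => ⟨x, hx, Sym2.eq_swap.trans h⟩⟩
  loopless := ⟨fun a h => by
    rcases h with ⟨-, h⟩ | ⟨x, hx, h⟩
    · exact h.ne rfl
    · have := P.parent_ne hx
      grind⟩

theorem joinCopies_adj_fibre {x : V} {y z : Y} :
    (P.joinCopies K f).Adj (x, y) (x, z) ↔ K.Adj y z := by
  refine ⟨fun h => ?_, fun h => Or.inl ⟨rfl, h⟩⟩
  rcases h with ⟨-, h⟩ | ⟨u, hu, h⟩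
  · exact h
  · have := P.parent_ne hu
    grind

theorem joinCopies_adj_parent {x : V} (hx : x ≠ r) :
    (P.joinCopies K f).Adj (x, f x) (P.parent x, f x) :=
  Or.inr ⟨x, hx, rfl⟩

theorem joinCopies_le_strongProd : P.joinCopies K f ≤ strongProd G K := by
  intro a b hab
  refine ⟨hab.ne, ?_⟩
  rcases hab with ⟨h, hK⟩ | ⟨x, hx, h⟩
  · exact ⟨Or.inl h, Or.inr hK⟩
  · have := P.adj_parent x hx
    rcases Sym2.eq_iff.1 h with ⟨rfl, rfl⟩ | ⟨rfl, rfl⟩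
    · exact ⟨Or.inr this, Or.inl rfl⟩
    · exact ⟨Or.inr this.symm, Or.inl rfl⟩

theorem joinCopies_connected (hK : K.Connected) : (P.joinCopies K f).Connected := by
  have hfibre (x : V) (y z : Y) : (P.joinCopies K f).Reachable (x, y) (x, z) :=
    (hK.preconnected y z).map ⟨fun y => (x, y), P.joinCopies_adj_fibre.2⟩
  obtain ⟨y₀⟩ := hK.nonempty
  refine connected_iff_exists_forall_reachable _ |>.2 ⟨(r, y₀), fun ⟨x, y⟩ => ?_⟩
  induction x using P.induction generalizing y with
  | root => exact hfibre r y₀ y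
  | step x hx ih =>
    exact (ih (f x)).trans ((P.joinCopies_adj_parent hx).symm.reachable.trans (hfibre x (f x) y))

variable [Finite V] [Finite Y]

theorem joinCopies_isCut {x : V} (hx : x ≠ r) :
    IsCut (P.joinCopies K f) (Nat.card Y) (x, f x) (P.parent x, f x) := by
  classical
  have := Fintype.ofFinite V
  have := Fintype.ofFinite Y
  let D : Finset V := {u | ∃ k, P.parent^[k] u = x ∧ G.dist r u = G.dist r x + k}
  have hD (u : V) : u ∈ D ↔ ∃ k, P.parent^[k] u = x ∧ G.dist r u = G.dist r x + k := by simp [D]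
  have hxD : x ∈ D := (hD x).2 ⟨0, rfl, rfl⟩
  have hpxD : P.parent x ∉ D := by
    have := P.dist_parent x hx
    rw [hD]
    lia
  have hclosed {u : V} (hu : u ≠ r) (hux : u ≠ x) : u ∈ D ↔ P.parent u ∈ D := by
    rw [hD, hD]
    have := P.dist_parent u hu
    refine ⟨?_, fun ⟨k, hk, hdist⟩ => ⟨k + 1, hk, by lia⟩⟩
    rintro ⟨_ | k, hk, hdist⟩
    · exact absurd hk hux
    · exact ⟨k, hk, by lia⟩
  refine ⟨D ×ˢ Finset.univ, by simpa, by simpa, by simp [Finset.card_product], ?_⟩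
  rintro ⟨u, y⟩ hu ⟨v, z⟩ hv h
  simp only [Finset.mem_product, Finset.mem_univ, and_true] at hu hv
  rcases h with h | ⟨w, hw, h⟩ <;> grind

theorem not_isCut_joinCopies (hK : K.Connected) (x : V) (y z : Y) :
    ¬ IsCut (P.joinCopies K f) (Nat.card Y) (x, y) (x, z) := by
  classical
  have := Fintype.ofFinite V
  have := Fintype.ofFinite Y
  rw [Nat.card_eq_fintype_card]
  rintro ⟨S, hy, hz, hdvd, hS⟩
  let fibre : V → Finset Y := fun u => {y | (u, y) ∈ S}
  have hdvd_fibre (u : V) (hu : u ≠ x) : Fintype.card Y ∣ (fibre u).card := by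
    have hstep (a b : Y) (hab : K.Adj a b) (ha : (u, a) ∈ S) : (u, b) ∈ S := by
      by_contra hb
      exact hu (congrArg Prod.fst (hS _ ha _ hb (P.joinCopies_adj_fibre.2 hab)).1)
    have hconst := eq_of_forall_adj_eq hK (f := fun a => (u, a) ∈ S)
      fun a b hab => propext ⟨hstep a b hab, hstep b a hab.symm⟩
    by_cases h : (u, y) ∈ S
    · simp [fibre, fun a => (hconst a y).trans (eq_true h)]
    · simp [fibre, fun a => (hconst a y).trans (eq_false h)]
  have hdvd_x : Fintype.card Y ∣ (fibre x).card := by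
    rw [card_eq_sum_card_fibre, ← Finset.sum_erase_add _ _ (Finset.mem_univ x)] at hdvd
    refine (Nat.dvd_add_right (Finset.dvd_sum fun u hu => ?_)).1 hdvd
    exact hdvd_fibre u (Finset.ne_of_mem_erase hu)
  have hpos : 0 < (fibre x).card := Finset.card_pos.2 ⟨y, by simpa [fibre]⟩
  have hlt : (fibre x).card < Fintype.card Y :=
    Finset.card_lt_univ_of_notMem (x := z) (by simpa [fibre])
  exact absurd (Nat.le_of_dvd hpos hdvd_x) (by lia)

section Automorphism

variable (σ : P.joinCopies K f ≃g P.joinCopies K f)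

theorem joinCopies_fst_apply_eq (hK : K.Connected) (x : V) (y z : Y) :
    (σ (x, y)).1 = (σ (x, z)).1 := by
  refine eq_of_forall_adj_eq hK (f := fun y => (σ (x, y)).1) (fun y z hyz => ?_) y z
  rcases σ.map_adj_iff.2 (P.joinCopies_adj_fibre.2 hyz) with ⟨h, -⟩ | ⟨u, hu, h⟩
  · exact h
  have hcut := (P.joinCopies_isCut (K := K) (f := f) hu).map σ.symm
  rcases Sym2.eq_iff.1 h with ⟨hy, hz⟩ | ⟨hy, hz⟩
  all_goals
    rw [← hy, ← hz, σ.symm_apply_apply, σ.symm_apply_apply] at hcut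
    exact absurd hcut (P.not_isCut_joinCopies hK _ _ _)

theorem joinCopies_snd_apply (hK : K.Connected) (hrigid : IsRigid K) (x : V) (y : Y) :
    (σ (x, y)).2 = y := by
  have hfst := P.joinCopies_fst_apply_eq σ hK
  have hinj : Function.Injective fun y => (σ (x, y)).2 := fun y z h =>
    (Prod.mk.inj (σ.injective (Prod.ext (hfst x y z) h))).2
  let π : K ≃g K := ⟨Equiv.ofBijective _ (Finite.injective_iff_bijective.1 hinj), fun {y z} => by
    refine Iff.trans ?_ (P.joinCopies_adj_fibre (f := f) (x := x))
    rw [← σ.map_adj_iff, ← Prod.mk.eta (p := σ (x, y)), ← Prod.mk.eta (p := σ (x, z)), hfst x z y]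
    exact P.joinCopies_adj_fibre.symm⟩
  exact hrigid π y

theorem joinCopies_isRigid (hV : 3 ≤ Nat.card V) (hK : K.Connected)
    (hrigid : IsRigid K) (hf : f.Injective) : IsRigid (P.joinCopies K f) := by
  rintro σ ⟨x, y⟩
  obtain ⟨τ, hτ⟩ : ∃ τ : V → V, ∀ x y, σ (x, y) = (τ x, y) :=
    ⟨fun x => (σ (x, y)).1, fun x z =>
      Prod.ext (P.joinCopies_fst_apply_eq σ hK x z y) (P.joinCopies_snd_apply σ hK hrigid x z)⟩
  have hτ_parent (x : V) (hx : x ≠ r) : s(τ x, τ (P.parent x)) = s(x, P.parent x) := by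
    have hadj := σ.map_adj_iff.2 (P.joinCopies_adj_parent (K := K) (f := f) hx)
    rw [hτ, hτ] at hadj
    rcases hadj with ⟨-, h⟩ | ⟨u, -, h⟩
    · exact absurd rfl h.ne
    · grind [Function.Injective]
  rw [hτ, P.apply_eq_of_sym2_eq hV hτ_parent]

end Automorphism

end ParentMap

theorem HasRigidSpanningSubgraph.strongProd {V Y : Type*} [Finite V] [Finite Y]
    {G : SimpleGraph V} (hG : G.Connected) (hV : 3 ≤ Nat.card V) {X : SimpleGraph Y}
    (hX : HasRigidSpanningSubgraph X) {f : V → Y} (hf : f.Injective) :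
    HasRigidSpanningSubgraph (strongProd G X) := by
  obtain ⟨K, hle, hconn, hrigid⟩ := hX
  obtain ⟨r⟩ := hG.nonempty
  obtain ⟨P⟩ := nonempty_parentMap hG r
  refine ⟨P.joinCopies K f, P.joinCopies_le_strongProd.trans ?_, P.joinCopies_connected hconn,
    P.joinCopies_isRigid hV hconn hrigid hf⟩
  exact fun a b hab => ⟨hab.1, hab.2.1, hab.2.2.imp_right fun h => hle h⟩

end JoinCopies

section SiblingLabeling

variable {V : Type*} {G : SimpleGraph V} {r : V}

/-- Labels for the vertices of a rooted tree that tell siblings apart. The root is labeled `0`, all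
other labels lie between `1` and `D`, and all of these occur at the children of the root. -/
structure SiblingLabeling (P : ParentMap G r) (D : ℕ) where
  label : V → ℕ
  label_eq_zero_iff : ∀ x, label x = 0 ↔ x = r
  label_le : ∀ x, label x ≤ D
  label_inj : ∀ x z, P.parent x = P.parent z → label x = label z → x = z
  exists_label_eq : ∀ i ≤ D, ∃ x, P.parent x = r ∧ label x = i

theorem nonempty_siblingLabeling [Finite V] (P : ParentMap G r)
    (hr : ∀ x, (G.neighborSet x).ncard ≤ (G.neighborSet r).ncard) :
    Nonempty (SiblingLabeling P (G.neighborSet r).ncard) := by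
  classical
  have hlabel (x : V) : ∃ e : V → ℕ,
      Set.BijOn e (G.neighborSet x) (Set.Icc 1 (G.neighborSet x).ncard) := by
    refine (Set.toFinite _).exists_bijOn_of_encard_eq ?_
    rw [← (Set.toFinite _).cast_ncard_eq, ← (Set.toFinite _).cast_ncard_eq, Set.ncard_Icc_nat]
    simp
  choose e he using hlabel
  have hmem {x : V} (hx : x ≠ r) : x ∈ G.neighborSet (P.parent x) := (P.adj_parent x hx).symm
  refine ⟨⟨fun x => if x = r then 0 else e (P.parent x) x, fun x => ?_, fun x => ?_,
    fun x z => ?_, fun i hi => ?_⟩⟩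
  · have := fun hx => ((he _).mapsTo (hmem (x := x) hx)).1
    grind
  · have := fun hx => ((he _).mapsTo (hmem (x := x) hx)).2
    grind
  · have := fun hx => ((he _).mapsTo (hmem (x := x) hx)).1
    have := fun hz => ((he _).mapsTo (hmem (x := z) hz)).1
    have (hx : x ≠ r) (hz : z ≠ r) (hp : P.parent x = P.parent z) :=
      (he (P.parent x)).injOn (hmem hx) (hp ▸ hmem hz)
    grind
  · rcases Nat.eq_zero_or_pos i with rfl | hpos
    · exact ⟨r, P.parent_root, if_pos rfl⟩
    obtain ⟨x, hx, rfl⟩ := (he r).surjOn ⟨hpos, hi⟩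
    have hxr : x ≠ r := hx.ne'
    have hpx : P.parent x = r := (P.parent_eq_root_iff hxr).2 hx
    exact ⟨x, hpx, by rw [if_neg hxr, hpx]⟩

namespace SiblingLabeling

variable {P : ParentMap G r} {D : ℕ} (L : SiblingLabeling P D)

/-- The oriented edges of `squareGraph`. The constructors `fstParent` and `sndParent` give the
Cartesian square of the tree without one edge, whose absence marks the vertex with both labels `1`.
The edges of `root` make `(r, r)` the vertex of largest degree, those of `fstAxis` and `sndAxis`
distinguish siblings, and those of `zigzag` link the copies of the children of the root on the two
axes to a path. -/
inductive SquareArc : V × V → V × V → Prop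
  | fstParent {x x' y : V} (hx : x ≠ r) (hx' : P.parent x = x')
      (h : ¬(x' = r ∧ P.parent y = r ∧ L.label x = 1 ∧ L.label y = 1)) : SquareArc (x, y) (x', y)
  | sndParent {x y y' : V} (hy : y ≠ r) (hy' : P.parent y = y') : SquareArc (x, y) (x, y')
  | root {x y : V} (hx : x ≠ r) (hy : y ≠ r) (hpx : P.parent x = r) (hpy : P.parent y = r) :
      SquareArc (x, y) (r, r)
  | fstAxis {x x' y : V} (hx : x ≠ r) (hx' : P.parent x = x') (hpy : P.parent y = r)
      (h : L.label x = L.label y) : SquareArc (x, r) (x', y)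
  | sndAxis {x y y' : V} (hy : y ≠ r) (hy' : P.parent y = y') (hpx : P.parent x = r)
      (h : L.label x = L.label y) : SquareArc (r, y) (x, y')
  | zigzag {x y : V} (hy : y ≠ r) (hpx : P.parent x = r) (hpy : P.parent y = r)
      (h : L.label x = L.label y + 1) : SquareArc (x, r) (r, y)

/-- A rigid spanning subgraph of the strong square of `G`. -/
def squareGraph : SimpleGraph (V × V) :=
  fromRel L.SquareArc

theorem squareGraph_adj {v w : V × V} :
    L.squareGraph.Adj v w ↔ v ≠ w ∧ (L.SquareArc v w ∨ L.SquareArc w v) :=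
  Iff.rfl

theorem squareGraph_le_strongProd : L.squareGraph ≤ strongProd G G := by
  have hchild {x : V} (hx : x ≠ r) (hpx : P.parent x = r) : G.Adj r x :=
    (P.parent_eq_root_iff hx).1 hpx
  have harc {v w : V × V} (h : L.SquareArc v w) :
      (v.1 = w.1 ∨ G.Adj v.1 w.1) ∧ (v.2 = w.2 ∨ G.Adj v.2 w.2) := by
    cases h <;> grind [L.label_eq_zero_iff, P.adj_parent, G.adj_comm]
  rintro v w ⟨hne, h | h⟩
  · exact ⟨hne, harc h⟩
  · exact ⟨hne, (harc h).1.imp Eq.symm Adj.symm, (harc h).2.imp Eq.symm Adj.symm⟩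

theorem squareGraph_connected : L.squareGraph.Connected := by
  refine connected_iff_exists_forall_reachable _ |>.2 ⟨(r, r), fun ⟨x, y⟩ => ?_⟩
  induction y using P.induction with
  | root =>
    induction x using P.induction with
    | root => rfl
    | step x hx ih =>
      refine ih.trans (Adj.reachable (L.squareGraph_adj.2 ⟨?_, Or.inr (.fstParent hx rfl ?_)⟩))
      · grind [P.parent_ne]
      · grind [L.label_eq_zero_iff]
  | step y hy ih =>
    refine ih.trans (Adj.reachable (L.squareGraph_adj.2 ⟨?_, Or.inr (.sndParent hy rfl)⟩))
    grind [P.parent_ne]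

section Degree

theorem squareGraph_adj_root_iff {x y : V} : L.squareGraph.Adj (r, r) (x, y) ↔
    P.parent x = r ∧ P.parent y = r ∧ (x ≠ r ∨ y ≠ r) := by
  grind [squareGraph_adj, SquareArc, P.parent_root, L.label_eq_zero_iff]

theorem ncard_setOf_parent_eq_root (L : SiblingLabeling P D) :
    {x | P.parent x = r}.ncard = D + 1 := by
  have himage : L.label '' {x | P.parent x = r} = Set.Icc 0 D :=
    Set.Subset.antisymm (Set.image_subset_iff.2 fun x _ => ⟨Nat.zero_le _, L.label_le x⟩)
      fun i hi => L.exists_label_eq i hi.2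
  have hinj : Set.InjOn L.label {x | P.parent x = r} :=
    fun x hx z hz h => L.label_inj x z (hx.trans hz.symm) h
  rw [← hinj.ncard_image, himage, Set.ncard_Icc_nat, Nat.sub_zero]

theorem ncard_neighborSet_root : (L.squareGraph.neighborSet (r, r)).ncard = (D + 1) ^ 2 - 1 := by
  have hset : L.squareGraph.neighborSet (r, r) =
      ({x | P.parent x = r} ×ˢ {y | P.parent y = r}) \ {(r, r)} := by
    ext ⟨x, y⟩
    simp only [mem_neighborSet, squareGraph_adj_root_iff, Set.mem_sdiff, Set.mem_prod,
      Set.mem_ofPred_eq, Set.mem_singleton_iff, Prod.mk.injEq, not_and_or, and_assoc, ne_eq]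
  rw [hset, Set.ncard_sdiff_singleton_of_mem (by simp [P.parent_root]), Set.ncard_prod,
    L.ncard_setOf_parent_eq_root, sq]

theorem exists_forall_eq_of_label (x : V) (i : ℕ) :
    ∃ c, ∀ z, P.parent z = x → L.label z = i → z = c := by
  by_cases h : ∃ c, P.parent c = x ∧ L.label c = i
  · obtain ⟨c, rfl, rfl⟩ := h
    exact ⟨c, fun z => L.label_inj z c⟩
  · exact ⟨r, fun z hz hi => absurd ⟨z, hz, hi⟩ h⟩

theorem exists_forall_adj_mem {v : V × V} (hv : v ≠ (r, r)) : ∃ a b c, ∀ w,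
    L.squareGraph.Adj v w → w.1 ≠ v.1 → w.2 ≠ v.2 → w ∈ ({a, b, c} : Set (V × V)) := by
  obtain ⟨x, y⟩ := v
  by_cases hx : x = r
  · obtain ⟨a, ha⟩ := L.exists_forall_eq_of_label r (L.label y)
    obtain ⟨b, hb⟩ := L.exists_forall_eq_of_label r (L.label y + 1)
    refine ⟨(a, P.parent y), (b, r), (r, r), ?_⟩
    grind [squareGraph_adj, SquareArc, P.parent_root, L.label_eq_zero_iff]
  by_cases hy : y = r
  · obtain ⟨a, ha⟩ := L.exists_forall_eq_of_label r (L.label x)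
    obtain ⟨b, hb⟩ := L.exists_forall_eq_of_label r (L.label x - 1)
    refine ⟨(P.parent x, a), (r, b), (r, r), ?_⟩
    grind [squareGraph_adj, SquareArc, P.parent_root, L.label_eq_zero_iff]
  · obtain ⟨a, ha⟩ := L.exists_forall_eq_of_label x (L.label y)
    obtain ⟨b, hb⟩ := L.exists_forall_eq_of_label y (L.label x)
    refine ⟨(a, r), (r, b), (r, r), ?_⟩
    grind [squareGraph_adj, SquareArc, P.parent_root, L.label_eq_zero_iff]

theorem ncard_neighborSet_le [Finite V] {v : V × V} (hv : v ≠ (r, r)) :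
    (L.squareGraph.neighborSet v).ncard ≤
      (G.neighborSet v.1).ncard + (G.neighborSet v.2).ncard + 3 := by
  obtain ⟨a, b, c, habc⟩ := L.exists_forall_adj_mem hv
  have hsub : L.squareGraph.neighborSet v ⊆ (fun x => (x, v.2)) '' G.neighborSet v.1 ∪
      (fun y => (v.1, y)) '' G.neighborSet v.2 ∪ {a, b, c} := by
    intro w hw
    obtain ⟨hne, hfst, hsnd⟩ := L.squareGraph_le_strongProd hw
    by_cases hx : w.1 = v.1
    · exact Or.inl (Or.inr ⟨w.2, by grind [mem_neighborSet], by grind⟩)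
    by_cases hy : w.2 = v.2
    · exact Or.inl (Or.inl ⟨w.1, by grind [mem_neighborSet], by grind⟩)
    · exact Or.inr (habc w hw hx hy)
  calc _ ≤ _ := Set.ncard_le_ncard hsub
    _ ≤ _ := Set.ncard_union_le _ _
    _ ≤ _ := add_le_add ((Set.ncard_union_le _ _).trans
      (add_le_add Set.ncard_image_le Set.ncard_image_le)) (ncard_insert_insert_singleton_le a b c)

theorem apply_root [Finite V] (hD : 2 ≤ D) (hdeg : ∀ x, (G.neighborSet x).ncard ≤ D)
    (σ : L.squareGraph ≃g L.squareGraph) : σ (r, r) = (r, r) := by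
  refine apply_eq_of_ncard_neighborSet_lt σ fun v hv => ?_
  have hle := L.ncard_neighborSet_le hv
  have hx := hdeg v.1
  have hy := hdeg v.2
  rw [L.ncard_neighborSet_root]
  have : (D + 1) ^ 2 - 1 = D * D + 2 * D := by rw [Nat.sub_eq_iff_eq_add] <;> ring_nf; lia
  nlinarith

end Degree

section Near

theorem mem_commonNeighbors_root_iff {x y : V} (hx : x ≠ r) (hy : y ≠ r) (hpx : P.parent x = r)
    (hpy : P.parent y = r) {v : V × V} : v ∈ L.squareGraph.commonNeighbors (r, r) (x, y) ↔
      v = (x, r) ∨ v = (r, y) ∧ ¬(L.label x = 1 ∧ L.label y = 1) := by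
  obtain ⟨a, b⟩ := v
  grind [mem_commonNeighbors, squareGraph_adj, SquareArc, P.parent_root, L.label_eq_zero_iff]

theorem squareGraph_adj_root_apply_iff (σ : L.squareGraph ≃g L.squareGraph)
    (hroot : σ (r, r) = (r, r)) {v : V × V} :
    L.squareGraph.Adj (r, r) (σ v) ↔ L.squareGraph.Adj (r, r) v := by
  simpa only [hroot] using σ.map_adj_iff (v := (r, r)) (w := v)

variable [Finite V]

theorem ncard_commonNeighbors_root_le_two {x y : V} (hx : x ≠ r) (hy : y ≠ r)
    (hpx : P.parent x = r) (hpy : P.parent y = r) :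
    (L.squareGraph.commonNeighbors (r, r) (x, y)).ncard ≤ 2 := by
  have hsub : L.squareGraph.commonNeighbors (r, r) (x, y) ⊆ {(x, r), (r, y)} := fun v hv =>
    ((L.mem_commonNeighbors_root_iff hx hy hpx hpy).1 hv).imp_right And.left
  exact (Set.ncard_le_ncard hsub).trans
    ((Set.ncard_insert_le _ _).trans_eq (by rw [Set.ncard_singleton]))

theorem ncard_commonNeighbors_root_le_one_iff {x y : V} (hx : x ≠ r) (hy : y ≠ r)
    (hpx : P.parent x = r) (hpy : P.parent y = r) :
    (L.squareGraph.commonNeighbors (r, r) (x, y)).ncard ≤ 1 ↔ L.label x = 1 ∧ L.label y = 1 := by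
  rw [Set.ncard_le_one_iff (Set.toFinite _)]
  simp only [L.mem_commonNeighbors_root_iff hx hy hpx hpy]
  refine ⟨fun h => ?_, by grind⟩
  have := @h (x, r) (r, y)
  grind

theorem two_lt_ncard_commonNeighbors_fst (hD : 2 ≤ D) {x : V} (hx : x ≠ r)
    (hpx : P.parent x = r) : 2 < (L.squareGraph.commonNeighbors (r, r) (x, r)).ncard := by
  obtain ⟨o, hpo, ho⟩ := L.exists_label_eq 1 (by lia)
  obtain ⟨q, hpq, hq⟩ := L.exists_label_eq 2 hD
  refine (Set.two_lt_ncard (Set.toFinite _)).2 ⟨(x, o), ?_, (x, q), ?_, (r, x), ?_, ?_⟩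
  all_goals
    grind [mem_commonNeighbors, squareGraph_adj, SquareArc, P.parent_root, L.label_eq_zero_iff]

theorem two_lt_ncard_commonNeighbors_snd (hD : 2 ≤ D) {y : V} (hy : y ≠ r)
    (hpy : P.parent y = r) : 2 < (L.squareGraph.commonNeighbors (r, r) (r, y)).ncard := by
  obtain ⟨o, hpo, ho⟩ := L.exists_label_eq 1 (by lia)
  obtain ⟨q, hpq, hq⟩ := L.exists_label_eq 2 hD
  refine (Set.two_lt_ncard (Set.toFinite _)).2
    ⟨(q, y), ?_, (y, r), ?_, if L.label y = 1 then (q, r) else (o, y), ?_, ?_⟩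
  all_goals
    grind [mem_commonNeighbors, squareGraph_adj, SquareArc, P.parent_root, L.label_eq_zero_iff]

theorem two_lt_ncard_commonNeighbors_root_iff (hD : 2 ≤ D) {v : V × V}
    (hv : L.squareGraph.Adj (r, r) v) :
    2 < (L.squareGraph.commonNeighbors (r, r) v).ncard ↔ v.1 = r ∨ v.2 = r := by
  obtain ⟨x, y⟩ := v
  obtain ⟨hpx, hpy, hne⟩ := L.squareGraph_adj_root_iff.1 hv
  by_cases hx : x = r
  · subst hx
    exact iff_of_true (L.two_lt_ncard_commonNeighbors_snd hD (by grind) hpy) (Or.inl rfl)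
  by_cases hy : y = r
  · subst hy
    exact iff_of_true (L.two_lt_ncard_commonNeighbors_fst hD hx hpx) (Or.inr rfl)
  · have := L.ncard_commonNeighbors_root_le_two hx hy hpx hpy
    simp only [hx, hy]
    lia

variable (σ : L.squareGraph ≃g L.squareGraph) (hroot : σ (r, r) = (r, r))

section

include hroot

theorem apply_mem_axes_iff (hD : 2 ≤ D) {v : V × V} (hv : L.squareGraph.Adj (r, r) v) :
    (σ v).1 = r ∨ (σ v).2 = r ↔ v.1 = r ∨ v.2 = r := by
  rw [← L.two_lt_ncard_commonNeighbors_root_iff hD hv, ← ncard_commonNeighbors_apply σ hroot,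
    L.two_lt_ncard_commonNeighbors_root_iff hD ((L.squareGraph_adj_root_apply_iff σ hroot).2 hv)]

/-- Because of the missing edge, `(o, o)` is the only neighbour of the root off the two axes that
has fewer than two common neighbours with it. -/
theorem apply_corner (hD : 2 ≤ D) {o : V} (hpo : P.parent o = r) (ho : L.label o = 1) :
    σ (o, o) = (o, o) := by
  have hor : o ≠ r := by grind [L.label_eq_zero_iff]
  have hadj : L.squareGraph.Adj (r, r) (o, o) := by grind [squareGraph_adj_root_iff]
  have hadj' := (L.squareGraph_adj_root_apply_iff σ hroot).2 hadj
  have haxes := L.apply_mem_axes_iff σ hroot hD hadj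
  have hcard := (L.ncard_commonNeighbors_root_le_one_iff hor hor hpo hpo).2 ⟨ho, ho⟩
  rw [← ncard_commonNeighbors_apply σ hroot] at hcard
  generalize σ (o, o) = v at hadj' haxes hcard ⊢
  obtain ⟨x, y⟩ := v
  have := L.ncard_commonNeighbors_root_le_one_iff (x := x) (y := y)
  grind [squareGraph_adj_root_iff, L.label_inj]

/-- The neighbours of the root on the two axes form a path with one end next to the corner, along
which they can be fixed one by one. -/
theorem apply_axes (hD : 2 ≤ D) {x : V} (hpx : P.parent x = r) :
    σ (x, r) = (x, r) ∧ σ (r, x) = (r, x) := by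
  induction hn : L.label x generalizing x with
  | zero =>
    obtain rfl := (L.label_eq_zero_iff x).1 hn
    exact ⟨hroot, hroot⟩
  | succ n ih =>
    have hx : x ≠ r := by grind [L.label_eq_zero_iff]
    obtain ⟨z, hpz, hz⟩ := L.exists_label_eq n (by have := L.label_le x; lia)
    have hfixed := ih hpz hz
    have hnext {a v : V × V} (ha : σ a = a) (hv : L.squareGraph.Adj (r, r) v)
        (hvr : v.1 = r ∨ v.2 = r) (hav : L.squareGraph.Adj a v)
        (huniq : ∀ w, L.squareGraph.Adj (r, r) w → w.1 = r ∨ w.2 = r → L.squareGraph.Adj a w →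
          w = v ∨ σ w = w) : σ v = v := by
      refine (huniq _ ((L.squareGraph_adj_root_apply_iff σ hroot).2 hv)
        ((L.apply_mem_axes_iff σ hroot hD hv).2 hvr) ?_).elim id fun h => σ.injective h
      rwa [← ha, σ.map_adj_iff]
    have hfst' : σ (x, r) = (x, r) := by
      rcases Nat.eq_zero_or_pos n with rfl | hpos
      · refine apply_eq_of_mem_commonNeighbors σ hroot (L.apply_corner σ hroot hD hpx hn)
          ((L.mem_commonNeighbors_root_iff hx hx hpx hpx).2 (Or.inl rfl)) fun w hw => ?_
        grind [L.mem_commonNeighbors_root_iff hx hx hpx hpx]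
      · refine hnext hfixed.2 ?_ (Or.inr rfl) ?_ fun w => ?_
        all_goals
          grind [squareGraph_adj, SquareArc, P.parent_root, L.label_eq_zero_iff, L.label_inj]
    refine ⟨hfst', hnext hfst' ?_ (Or.inl rfl) ?_ fun w => ?_⟩
    all_goals
      grind [squareGraph_adj, SquareArc, P.parent_root, L.label_eq_zero_iff, L.label_inj]

theorem apply_near (hD : 2 ≤ D) {x y : V} (hpx : P.parent x = r) (hpy : P.parent y = r) :
    σ (x, y) = (x, y) := by
  by_cases hxy : x = r ∨ y = r
  · grind [L.apply_axes σ hroot hD hpx, L.apply_axes σ hroot hD hpy]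
  have hadj : L.squareGraph.Adj (r, r) (x, y) := by grind [squareGraph_adj_root_iff]
  by_cases hcorner : L.label x = 1 ∧ L.label y = 1
  · obtain rfl : x = y := L.label_inj x y (hpx.trans hpy.symm) (hcorner.1.trans hcorner.2.symm)
    exact L.apply_corner σ hroot hD hpx hcorner.1
  have hmem := (L.squareGraph_adj_root_apply_iff σ hroot).2 hadj
  have haxes := L.apply_mem_axes_iff σ hroot hD hadj
  have hσ := apply_mem_commonNeighbors σ (L.apply_axes σ hroot hD hpx).1
    (L.apply_axes σ hroot hD hpy).2 (v := (x, y))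
  generalize σ (x, y) = v at hmem haxes hσ ⊢
  obtain ⟨a, b⟩ := v
  grind [mem_commonNeighbors, squareGraph_adj, SquareArc, P.parent_root, L.label_eq_zero_iff]

end

end Near

section Far

open Classical in
/-- Twice the distance to `(r, r)` in the Cartesian square of the tree, raised by one on the two
axes so that a vertex of an axis ranks above the vertices of equal distance off the axes. -/
noncomputable def squareRank (G : SimpleGraph V) (r : V) (v : V × V) : ℕ :=
  2 * (G.dist r v.1 + G.dist r v.2) + if v.1 = r ∨ v.2 = r then 1 else 0

theorem isAnchorPair_inner {x y : V} (hx : x ≠ r) (hy : y ≠ r)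
    (hxy : ¬(P.parent x = r ∧ P.parent y = r)) :
    IsAnchorPair L.squareGraph (squareRank G r) (x, y) (P.parent x, y) (x, P.parent y) := by
  have hr : G.dist r r = 0 := dist_self
  have hd := P.dist_parent
  constructor <;> simp only [mem_commonNeighbors, squareRank]
  all_goals grind [P.parent_root, L.label_eq_zero_iff, squareGraph_adj, SquareArc]

theorem exists_isAnchorPair_fst {x : V} (hpx : P.parent x ≠ r) :
    ∃ a b, IsAnchorPair L.squareGraph (squareRank G r) (x, r) a b := by
  obtain ⟨y, hpy, hy⟩ := L.exists_label_eq (L.label x) (L.label_le x)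
  refine ⟨(P.parent x, r), (P.parent x, y), ?_⟩
  have hr : G.dist r r = 0 := dist_self
  have hd := P.dist_parent
  constructor <;> simp only [mem_commonNeighbors, squareRank]
  all_goals grind [P.parent_root, L.label_eq_zero_iff, squareGraph_adj, SquareArc, L.label_inj]

theorem exists_isAnchorPair_snd {y : V} (hpy : P.parent y ≠ r) :
    ∃ a b, IsAnchorPair L.squareGraph (squareRank G r) (r, y) a b := by
  obtain ⟨x, hpx, hx⟩ := L.exists_label_eq (L.label y) (L.label_le y)
  refine ⟨(r, P.parent y), (x, P.parent y), ?_⟩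
  have hr : G.dist r r = 0 := dist_self
  have hd := P.dist_parent
  constructor <;> simp only [mem_commonNeighbors, squareRank]
  all_goals grind [P.parent_root, L.label_eq_zero_iff, squareGraph_adj, SquareArc, L.label_inj]

theorem exists_isAnchorPair {v : V × V} (hv : ¬(P.parent v.1 = r ∧ P.parent v.2 = r)) :
    ∃ a b, IsAnchorPair L.squareGraph (squareRank G r) v a b := by
  obtain ⟨x, y⟩ := v
  by_cases hx : x = r
  · subst hx
    exact L.exists_isAnchorPair_snd fun h => hv ⟨P.parent_root, h⟩
  by_cases hy : y = r
  · subst hy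
    exact L.exists_isAnchorPair_fst fun h => hv ⟨h, P.parent_root⟩
  · exact ⟨_, _, L.isAnchorPair_inner hx hy hv⟩

end Far

theorem squareGraph_isRigid [Finite V] (hD : 2 ≤ D)
    (hdeg : ∀ x, (G.neighborSet x).ncard ≤ D) : IsRigid L.squareGraph := fun σ =>
  apply_eq_of_isAnchorPair σ (squareRank G r) {v | P.parent v.1 = r ∧ P.parent v.2 = r}
    (fun _ hv => L.apply_near σ (L.apply_root hD hdeg σ) hD hv.1 hv.2)
    fun _ hv => L.exists_isAnchorPair hv

end SiblingLabeling

theorem exists_two_le_ncard_neighborSet [Finite V] (hG : G.Connected) (hV : 3 ≤ Nat.card V) :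
    ∃ x, 2 ≤ (G.neighborSet x).ncard := by
  have : Nontrivial V := Finite.one_lt_card_iff_nontrivial.1 (by lia)
  by_contra! hle
  choose τ hτ using hG.preconnected.exists_adj_of_nontrivial
  have heq {x y : V} (hxy : G.Adj x y) : τ x = y :=
    Set.ncard_le_one_iff (Set.toFinite _) |>.1 (Nat.le_of_lt_succ (hle x)) (hτ x) hxy
  obtain ⟨r⟩ := hG.nonempty
  obtain ⟨P⟩ := nonempty_parentMap hG r
  have hfix := P.apply_eq_of_sym2_eq hV (τ := τ)
    (fun x hx => by rw [heq (P.adj_parent x hx), heq (P.adj_parent x hx).symm, Sym2.eq_swap]) r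
  exact (hτ r).ne hfix.symm

theorem hasRigidSpanningSubgraph_strongProd_self [Finite V] (hG : G.Connected)
    (hV : 3 ≤ Nat.card V) : HasRigidSpanningSubgraph (strongProd G G) := by
  have := hG.nonempty
  obtain ⟨r, hr⟩ := Finite.exists_max fun x => (G.neighborSet x).ncard
  obtain ⟨x, hx⟩ := exists_two_le_ncard_neighborSet hG hV
  obtain ⟨P⟩ := nonempty_parentMap hG r
  obtain ⟨L⟩ := nonempty_siblingLabeling P hr
  exact ⟨L.squareGraph, L.squareGraph_le_strongProd, L.squareGraph_connected,
    L.squareGraph_isRigid (hx.trans (hr x)) hr⟩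

end SiblingLabeling

theorem hasRigidSpanningSubgraph_strongPower {V : Type*} [Finite V] {G : SimpleGraph V}
    (hG : G.Connected) (hV : 3 ≤ Nat.card V) :
    ∀ k, HasRigidSpanningSubgraph (G.strongPower (k + 2))
  | 0 => (hasRigidSpanningSubgraph_strongProd_self hG hV).of_iso (strongPowerTwoIso G)
  | k + 1 => ((hasRigidSpanningSubgraph_strongPower hG hV k).strongProd hG hV
      (f := fun x _ => x) fun _ _ h => congrFun h 0).of_iso (strongPowerSuccIso G (k + 2))

theorem eq_top_of_card_eq_two {V : Type*} {G : SimpleGraph V} (hG : G.Preconnected)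
    (hV : Nat.card V = 2) : G = ⊤ := by
  refine eq_top_iff_forall_ne_adj.2 fun a b hab => ?_
  have : Nontrivial V := ⟨a, b, hab⟩
  obtain ⟨c, hc⟩ := hG.exists_adj_of_nontrivial a
  rwa [((Nat.card_eq_two_iff' a).1 hV).unique hab.symm hc.ne']

theorem mainTheorem8_general {V : Type*} [Fintype V] (G : SimpleGraph V) (hG : G.Connected)
    {Δ : ℕ} (hΔ : 2 ≤ Δ) (hcard : 7 ≤ Fintype.card V ^ Δ) :
    (G.strongPower Δ).distinguishingIndex = 2 := by
  have hnontrivial : Nontrivial V := by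
    rw [← Fintype.one_lt_card_iff_nontrivial]
    by_contra! h
    have := Nat.pow_le_pow_left h Δ
    rw [one_pow] at this
    lia
  refine le_antisymm ?_ (two_le_distinguishingIndex_strongPower G hΔ)
  by_cases hV : 3 ≤ Nat.card V
  · obtain ⟨k, rfl⟩ := Nat.exists_eq_add_of_le' hΔ
    obtain ⟨H, hle, -, hrigid⟩ := hasRigidSpanningSubgraph_strongPower hG hV k
    exact distinguishingIndex_le_two_of_isRigid hle hrigid
  · have := Finite.one_lt_card (α := V)
    rw [eq_top_of_card_eq_two hG.preconnected (by lia), strongPower_top]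
    obtain ⟨H, hH⟩ := exists_isRigid (V := Fin Δ → V)
      (by rw [Fintype.card_fun, Fintype.card_fin]; lia)
    exact distinguishingIndex_le_two_of_isRigid le_top hH

theorem mainTheorem8 {V : Type*} [Fintype V] [Nontrivial V] (G : SimpleGraph V)
    [DecidableRel G.Adj] (hG : G.Connected) (Δ : ℕ) (hΔ : 2 ≤ Δ) (hdeg : G.maxDegree ≤ Δ)
    (hcard : 7 ≤ Fintype.card V ^ Δ) :
    (G.strongPower Δ).distinguishingIndex = 2 :=
  mainTheorem8_general G hG hΔ hcard
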